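/- Let $k$ be an algebraically closed field. A variety is a reduced, separated scheme of finite type over $k$; its points are its $k$-rational points. An algebraic group is a variety with a group structure whose multiplication and inverse are morphisms; an abelian variety is a complete connected algebraic group. An algebraic semigroup $(S,\mu)$ is a variety $S$ with an associative morphism $\mu : S\times S\to S$, and homomorphisms of algebraic semigroups are morphisms of varieties compatible with the laws. Let $A$ be an abelian variety with group law denoted additively, let $\mu$ be an algebraic semigroup law on $A$, and let $e$ be an idempotent of $(A,\mu)$, chosen as the neutral element of $(A,+)$. We also write $e$ for the neutral element of any other abelian variety. (i) There exists a decomposition of algebraic semigroups $$(A,\mu) \cong (A_0,\mu_0)\times(A_l,\mu_l)\times(A_r,\mu_r)\times(B,+),$$ sending $e$ to $(e,e,e,e)$, where $A_0, A_l, A_r, B$ are abelian varieties, $\mu_0(x,y)=e$, $\mu_l(x,y)=x$, $\mu_r(x,y)=y$, and $+$ is the group law of $B$. Every such decomposition is also an isomorphism of algebraic groups $A \cong A_0\times A_l\times A_r\times B$. The decomposition is unique: given two of them, with isomorphisms $\Phi : A \to A_0\times A_l\times A_r\times B$ and $\Phi' : A\to A_0'\times A_l'\times A_r'\times B'$, there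 are unique isomorphisms of varieties $f_0 : A_0\to A_0'$, $f_l : A_l\to A_l'$, $f_r : A_r\to A_r'$, $f_B : B\to B'$, all of them isomorphisms of algebraic groups, such that $\Phi' = (f_0\times f_l\times f_r\times f_B)\circ\Phi$. (ii) For every such decomposition, the projection $\varphi : A\to B$ is the universal homomorphism of $(A,\mu)$ to an algebraic group: it is a homomorphism of algebraic semigroups $(A,\mu)\to(B,+)$, and every homomorphism of algebraic semigroups from $(A,\mu)$ to an algebraic group $\mathcal{G}$ is $g\circ\varphi$ for a unique homomorphism of algebraic groups $g : B\to\mathcal{G}$. Moreover, the set of idempotents of $(A,\mu)$ is $\{e\}\times A_l\times A_r\times\{e\}$, and $(A,\mu)$ has a smallest (non-empty) two-sided ideal, its kernel, which is $\{e\}\times A_l\times A_r\times B$. -/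

import Mathlib

open CategoryTheory MonoidalCategory CartesianMonoidalCategory MonObj AlgebraicGeometry

universe u v

namespace AlgSemigroup

section Laws

variable {C : Type u} [Category.{v} C] [CartesianMonoidalCategory C]

/-- A composition law `m : X × X ⟶ X` is a semigroup law if it is associative. -/
def IsSemigroupLaw {X : C} (m : X ⊗ X ⟶ X) : Prop :=
  m ▷ X ≫ m = (α_ X X X).hom ≫ X ◁ m ≫ m

/-- A morphism `f : X ⟶ Y` is a homomorphism from the law `m` to the law `n`:
`f (x y) = f x f y`. -/
def IsSemigroupHom {X Y : C} (m : X ⊗ X ⟶ X) (n : Y ⊗ Y ⟶ Y) (f : X ⟶ Y) : Prop :=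
  m ≫ f = (f ⊗ₘ f) ≫ n

/-- The product of two laws: `(x, y) (x', y') = (x x', y y')`. -/
def prodLaw {X Y : C} (m : X ⊗ X ⟶ X) (n : Y ⊗ Y ⟶ Y) : (X ⊗ Y) ⊗ (X ⊗ Y) ⟶ X ⊗ Y :=
  lift ((fst X Y ⊗ₘ fst X Y) ≫ m) ((snd X Y ⊗ₘ snd X Y) ≫ n)

/-- The trivial law `(x, y) ↦ o` given by a point `o`. -/
def zeroLaw {X : C} (o : 𝟙_ C ⟶ X) : X ⊗ X ⟶ X := toUnit (X ⊗ X) ≫ o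

/-- The trivial law `(x, y) ↦ x`. -/
def leftLaw (X : C) : X ⊗ X ⟶ X := fst X X

/-- The trivial law `(x, y) ↦ y`. -/
def rightLaw (X : C) : X ⊗ X ⟶ X := snd X X

/-- The product `x y` of two points with respect to the law `m`. -/
def pointMul {X : C} (m : X ⊗ X ⟶ X) (x y : 𝟙_ C ⟶ X) : 𝟙_ C ⟶ X := lift x y ≫ m

/-- The set of idempotent points. -/
def idempotents {X : C} (m : X ⊗ X ⟶ X) : Set (𝟙_ C ⟶ X) := {x | pointMul m x x = x}

/-- Two-sided ideals; as usual they are non-empty. -/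
structure IsTwoSidedIdeal {X : C} (m : X ⊗ X ⟶ X) (I : Set (𝟙_ C ⟶ X)) : Prop where
  nonempty : I.Nonempty
  mul_left : ∀ x, ∀ y ∈ I, pointMul m x y ∈ I
  mul_right : ∀ x, ∀ y ∈ I, pointMul m y x ∈ I

/-- `I` is the kernel of `(X, m)`: the smallest two-sided ideal. -/
def IsKernel {X : C} (m : X ⊗ X ⟶ X) (I : Set (𝟙_ C ⟶ X)) : Prop :=
  IsLeast {J | IsTwoSidedIdeal m J} I

end Laws

section Varieties

variable {K : Type u} [Field K]

/-- Varieties: reduced separated schemes of finite type over `K` (used for `K` algebraically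
closed). A group object on a variety is an algebraic group. -/
structure IsVariety (X : Over (Spec (.of K))) : Prop where
  isReduced : IsReduced X.left
  isSeparated : IsSeparated X.hom
  locallyOfFiniteType : LocallyOfFiniteType X.hom
  quasiCompact : QuasiCompact X.hom

/-- Abelian varieties: proper geometrically integral group schemes over a field. For `K`
algebraically closed, these are the complete connected algebraic groups. -/
structure IsAbelianVariety (A : Over (Spec (.of K))) [GrpObj A] : Prop where
  isProper : IsProper A.hom
  geometricallyIntegral : GeometricallyIntegral A.hom

/-- `φ : (S, m) ⟶ G` is the universal homomorphism of the semigroup `(S, m)` to an algebraic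
group. -/
structure IsUniversalHomToGroup {S G : Over (Spec (.of K))} (m : S ⊗ S ⟶ S) [GrpObj G]
    (φ : S ⟶ G) : Prop where
  isVariety : IsVariety G
  isHom : IsSemigroupHom m μ[G] φ
  existsUnique_fac : ∀ (H : Over (Spec (.of K))) [GrpObj H], IsVariety H →
    ∀ f : S ⟶ H, IsSemigroupHom m μ[H] f → ∃! g : G ⟶ H, IsMonHom g ∧ φ ≫ g = f

/-- A decomposition `(A, m) = (A0, zero law) × (Al, left law) × (Ar, right law) × (B, group law)`
of semigroups, where the four factors are abelian varieties and the neutral element of `A`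
corresponds to the tuple of the neutral elements of the factors. -/
structure Decomposition (A : Over (Spec (.of K))) [GrpObj A] (m : A ⊗ A ⟶ A) where
  A0 : Over (Spec (.of K))
  Al : Over (Spec (.of K))
  Ar : Over (Spec (.of K))
  B : Over (Spec (.of K))
  [grpA0 : GrpObj A0]
  [grpAl : GrpObj Al]
  [grpAr : GrpObj Ar]
  [grpB : GrpObj B]
  abelianA0 : IsAbelianVariety A0
  abelianAl : IsAbelianVariety Al
  abelianAr : IsAbelianVariety Ar
  abelianB : IsAbelianVariety B
  iso : A ≅ A0 ⊗ (Al ⊗ (Ar ⊗ B))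
  isHom : IsSemigroupHom m
    (prodLaw (zeroLaw η[A0]) (prodLaw (leftLaw Al) (prodLaw (rightLaw Ar) μ[B]))) iso.hom
  map_one : η[A] ≫ iso.hom = lift η[A0] (lift η[Al] (lift η[Ar] η[B]))

attribute [instance] Decomposition.grpA0 Decomposition.grpAl Decomposition.grpAr
  Decomposition.grpB

namespace Decomposition

variable {A : Over (Spec (.of K))} [GrpObj A] {m : A ⊗ A ⟶ A} (D : Decomposition A m)

/-- The projection `A ⟶ A0`. -/
noncomputable def projA0 : A ⟶ D.A0 := D.iso.hom ≫ fst _ _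

/-- The projection `A ⟶ B`. -/
noncomputable def projB : A ⟶ D.B := D.iso.hom ≫ snd _ _ ≫ snd _ _ ≫ snd _ _

end Decomposition

end Varieties

end AlgSemigroup

/-! Write `A` additively with `e = 0`. By rigidity (`eq_const_of_const_on_axes`), a pointed morphism
from a product of two abelian varieties to a third is the sum of its restrictions to the axes
(`eq_mul_of_map_one`), and pointed morphisms are homomorphisms. Hence `m (x, y) = φ x + ψ y` with
endomorphisms `φ x = x e` and `ψ y = e y`, and associativity says exactly that `φ` and `ψ` are
commuting idempotents.

The idempotents `(1 - φ)(1 - ψ)`, `φ(1 - ψ)`, `(1 - φ)ψ`, `φψ` are then orthogonal with sum `1`.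
Their images are abelian varieties (`IsAbelianVariety.exists_splitting`) whose product is `A`. On
them `(φ, ψ)` acts as `(0, 0)`, `(1, 0)`, `(0, 1)`, `(1, 1)`, so the law becomes `0`, `x`, `y`, `x +
y`.

For uniqueness, the four idempotents attached to any decomposition are given by formulas in `m` and
`e` alone. For the universal property, a homomorphism `f` to a group kills the idempotent `e`, so `f
x = f (e (x e))`, which depends only on the `B`-component of `x`. -/

namespace AlgSemigroup

/-! ### Rigidity for proper schemes -/

section Rigidity

variable {K : Type u} [Field K]

lemma isClosedImmersion_left_of_point {X : Over (Spec (.of K))} [IsSeparated X.hom]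
    (x : 𝟙_ (Over (Spec (.of K))) ⟶ X) : IsClosedImmersion x.left :=
  isClosedImmersion_of_comp_eq_id (Y := Spec (.of K)) X.hom x.left (by simp)

open Limits in
/-- Rigidity: a morphism from a product of two proper schemes that is constant on both axes
is constant. -/
theorem eq_const_of_const_on_axes [IsAlgClosed K] {X Y Z : Over (Spec (.of K))}
    [IsProper X.hom] [IsProper Y.hom] [IsProper Z.hom] [IsIntegral (X ⊗ Y).left]
    (x₀ : 𝟙_ (Over (Spec (.of K))) ⟶ X) (y₀ : 𝟙_ (Over (Spec (.of K))) ⟶ Y)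
    (z₀ : 𝟙_ (Over (Spec (.of K))) ⟶ Z) (F : X ⊗ Y ⟶ Z)
    (h₁ : x₀ ▷ Y ≫ F = toUnit _ ≫ z₀) (h₂ : X ◁ y₀ ≫ F = toUnit _ ≫ z₀) :
    F = toUnit _ ≫ z₀ := by
  let S := Spec (.of K)
  let point : S := IsLocalRing.closedPoint K
  have hpoint : IsClosed {point} := isClosed_discrete _
  have : Nonempty Y.left := ⟨y₀.left point⟩
  have : IsProper (X ⊗ Y).hom := by dsimp; infer_instance
  have : JacobsonSpace (X ⊗ Y).left := LocallyOfFiniteType.jacobsonSpace (Y := Spec _) (X ⊗ Y).hom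
  have : Surjective Y.hom := ⟨Function.surjective_to_subsingleton (α := Y.left) (β := Spec _) _⟩
  have : IsProper (fst X Y).left := by dsimp; infer_instance
  have : IsProper (fst X Z).left := by dsimp; infer_instance
  have : Surjective (fst X Y).left := by dsimp; infer_instance
  have : IsClosedImmersion x₀.left := isClosedImmersion_left_of_point x₀
  have : IsProper (X ⊗ Z).hom := by dsimp; infer_instance
  have : IsClosedImmersion (lift x₀ z₀).left := isClosedImmersion_left_of_point (lift x₀ z₀)
  -- Working with the graph `(x, y) ↦ (x, F (x, y))` turns statements about `F` on fibres into
  -- statements about a proper morphism over `X`.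
  let Γ : X ⊗ Y ⟶ X ⊗ Z := lift (fst _ _) F
  have hΓ : Γ ≫ fst X Z = fst X Y := lift_fst _ _
  have hΓ' : Γ.left ≫ (fst X Z).left = (fst X Y).left := by rw [← Over.comp_left, hΓ]
  have hΓ_apply (z : (X ⊗ Y).left) : (fst X Z).left (Γ.left z) = (fst X Y).left z := by
    rw [← Scheme.Hom.comp_apply, hΓ']
  have : IsProper (Γ.left ≫ (fst X Z).left) := by rwa [hΓ']
  have : IsProper Γ.left := .of_comp _ (fst X Z).left
  ext1
  -- By the Jacobson property a failure would occur at a closed point. Over an algebraically closed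
  -- field this is a rational point of `{x₀} × Y`, where `F` is `z₀` by `h₁`.
  have H : Γ.left '' ((fst X Y).left ⁻¹' {x₀.left point}) ⊆ {(lift x₀ z₀).left point} := by
    rw [Set.image_subset_iff, ← Set.sdiff_eq_empty, ← Set.not_nonempty_iff_eq_empty]
    intro H
    obtain ⟨c₀, ⟨hc₁, hc₂⟩, hc₃⟩ := nonempty_inter_closedPoints H <| by
      rw [Set.sdiff_eq_compl_inter, ← Set.image_singleton, ← Set.image_singleton];
      refine (IsOpen.isLocallyClosed ?_).inter (IsClosed.isLocallyClosed ?_)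
      · exact (((lift x₀ z₀).left.isClosedMap _ hpoint).preimage Γ.left.continuous).isOpen_compl
      · exact (x₀.left.isClosedMap _ hpoint).preimage (fst X Y).left.continuous
    obtain ⟨⟨c, hc⟩, e⟩ := (pointEquivClosedPoint (X ⊗ Y).hom).surjective ⟨c₀, hc₃⟩
    obtain rfl : c point = c₀ := congr(($e).1)
    let c' : 𝟙_ (Over S) ⟶ X ⊗ Y := Over.homMk c hc
    have hc' : c' ≫ fst X Y = x₀ := by
      ext1
      refine ext_of_apply_closedPoint_eq X.hom (Over.w (c' ≫ fst X Y)) (Over.w x₀) ?_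
      rw [Over.comp_left]
      exact hc₁
    have h : c' = lift (𝟙 _) (c' ≫ snd X Y) ≫ x₀ ▷ Y := by
      apply CartesianMonoidalCategory.hom_ext <;> simp [hc']
    have h' : c' ≫ Γ = lift x₀ z₀ := by
      apply CartesianMonoidalCategory.hom_ext
      · simp [Γ, hc']
      · rw [Category.assoc, lift_snd, lift_snd, h, Category.assoc, h₁, ← Category.assoc,
          toUnit_unique (_ ≫ toUnit _) (𝟙 _), Category.id_comp]
    refine hc₂ ?_
    rw [← h', Over.comp_left, Set.mem_preimage, Set.mem_singleton_iff, Scheme.Hom.comp_apply]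
    rfl
  -- The image of `Γ` has a finite fibre over `x₀`, so by properness it is finite over a
  -- neighbourhood `U` of `x₀`.
  obtain ⟨U, hηU, H⟩ := exists_finite_imageι_comp_morphismRestrict_of_finite_image_preimage
    Γ.left (fst X Z).left (x₀.left point) (by
      rw [hΓ']
      exact (Set.finite_singleton _).subset H)
  have H (x : U.toScheme) : ((fst X Z).left ⁻¹' {U.ι x} ∩ Set.range Γ.left).Finite := by
    refine ((((Γ.left.imageι ≫ (fst X Z).left) ∣_ U).finite_preimage_singleton x).image
      (Scheme.Opens.ι _ ≫ Γ.left.imageι)).subset ?_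
    rintro _ ⟨hx, z, rfl⟩
    have hz : Γ.left.imageι (Γ.left.toImage z) = Γ.left z := by
      rw [← Scheme.Hom.comp_apply, Scheme.Hom.toImage_imageι]
    have hw : (Γ.left.imageι ≫ (fst X Z).left) (Γ.left.toImage z) = U.ι x := by
      rw [Scheme.Hom.comp_apply, hz]
      exact hx
    obtain ⟨w, hw'⟩ : ∃ w, ((Γ.left.imageι ≫ (fst X Z).left) ⁻¹ᵁ U).ι w = Γ.left.toImage z := by
      rw [← Set.mem_range, Scheme.Opens.range_ι]
      change (Γ.left.imageι ≫ (fst X Z).left) (Γ.left.toImage z) ∈ U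
      rw [hw]
      exact x.2
    refine ⟨w, U.ι.isOpenEmbedding.injective ?_, ?_⟩
    · rw [← Scheme.Hom.comp_apply, morphismRestrict_ι, Scheme.Hom.comp_apply, hw', hw]
    · rw [Scheme.Hom.comp_apply, hw', hz]
  have : LocallyOfFiniteType (F.left ≫ Z.hom) := by rw [Over.w]; infer_instance
  -- The source is integral and the target separated, so agreement at the closed points of a dense
  -- open subset suffices.
  refine ext_of_apply_eq Z.hom _
    ((fst X Y).left ⁻¹ᵁ U).isOpen.isLocallyClosed
    (((fst X Y).left ⁻¹ᵁ U).isOpen.dense ?_) ?_ ?_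
  · exact .preimage ⟨_, hηU⟩ (fst X Y).left.surjective
  · intro y hyU hy
    have hx : IsClosed {(fst X Y).left y} := by simpa using (fst X Y).left.isClosedMap _ hy
    let x : 𝟙_ _ ⟶ X := Over.homMk (pointOfClosedPoint X.hom _ hx) (by simp)
    -- The map `(x, y) ↦ (x, y₀)`, which moves a point within its fibre over `X` to the axis where
    -- `F` is known.
    let p : X ⊗ Y ⟶ X ⊗ Y := fst X Y ≫ (ρ_ _).inv ≫ X ◁ y₀
    have hp : p ≫ fst X Y = fst X Y := by simp [p]
    have hpF : p ≫ F = toUnit _ ≫ z₀ := by simp [p, h₂]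
    -- The fibre `{x} × Y` is irreducible and its image under the closed map `Γ` is finite, so that
    -- image is a single point.
    have : Γ.left y = Γ.left (p.left y) := by
      refine subsingleton_image_closure_of_finite_of_isPreirreducible
        (hx.preimage (fst X Y).left.continuous).isLocallyClosed ?_ Γ.left.continuous
        Γ.left.isClosedMap ((H ⟨_, hyU⟩).subset (Set.image_subset_iff.mpr fun z hz ↦
          ⟨(hΓ_apply z).trans hz, Set.mem_range_self z⟩)) ?_ ?_
      · let α : X ⊗ Y ⟶ X ⊗ Y := toUnit _ ≫ x ⊗ₘ 𝟙 _
        have : Nonempty X.left := ⟨x₀.left point⟩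
        have : Surjective X.hom :=
          ⟨Function.surjective_to_subsingleton (α := X.left) (β := Spec _) _⟩
        convert!
          ((IrreducibleSpace.isIrreducible_univ _).image α.left
              α.left.continuous.continuousOn).isPreirreducible
        rw [Over.tensorHom_left]
        simp [Set.range_comp, Scheme.Pullback.range_map, x]
      · exact ⟨y, subset_closure rfl, rfl⟩
      · refine ⟨p.left y, subset_closure ?_, rfl⟩
        rw [Set.mem_preimage, Set.mem_singleton_iff, ← Scheme.Hom.comp_apply, ← Over.comp_left, hp]
    have key := congr((snd X Z).left $this)
    rw [← Scheme.Hom.comp_apply, ← Scheme.Hom.comp_apply, ← Scheme.Hom.comp_apply,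
      ← Over.comp_left, ← Over.comp_left, lift_snd, hpF] at key
    exact key
  · rw [Over.w, Over.w]

end Rigidity

/-! ### Pointed morphisms of abelian varieties -/

section AbelianVariety

variable {K : Type u} [Field K]

lemma IsAbelianVariety.isVariety {A : Over (Spec (.of K))} [GrpObj A] (hA : IsAbelianVariety A) :
    IsVariety A := by
  have := hA.isProper
  have := hA.geometricallyIntegral
  have : IsIntegral A.left := GeometricallyIntegral.isIntegral_of_subsingleton A.hom
  exact ⟨inferInstance, inferInstance, inferInstance, inferInstance⟩

lemma IsAbelianVariety.isIntegral_tensorObj {A B : Over (Spec (.of K))} [GrpObj A] [GrpObj B]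
    (hA : IsAbelianVariety A) (hB : IsAbelianVariety B) : IsIntegral (A ⊗ B).left := by
  have := hA.isProper
  have := hA.geometricallyIntegral
  have := hB.geometricallyIntegral
  have : IsIntegral A.left := GeometricallyIntegral.isIntegral_of_subsingleton A.hom
  have : IsLocallyNoetherian A.left := LocallyOfFiniteType.isLocallyNoetherian A.hom
  dsimp
  infer_instance

lemma IsAbelianVariety.isCommMonObj {A : Over (Spec (.of K))} [GrpObj A]
    (hA : IsAbelianVariety A) : IsCommMonObj A :=
  have := hA.isProper
  have := hA.geometricallyIntegral
  isCommMonObj_of_isProper_of_geometricallyIntegral A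

variable [IsAlgClosed K]

/-- A pointed morphism from a product of two abelian varieties to an abelian variety is the
product of its restrictions to the two axes. -/
theorem eq_mul_of_map_one {A B C : Over (Spec (.of K))} [GrpObj A] [GrpObj B] [GrpObj C]
    (hA : IsAbelianVariety A) (hB : IsAbelianVariety B) (hC : IsAbelianVariety C)
    (F : A ⊗ B ⟶ C) (hF : lift η[A] η[B] ≫ F = η[C]) :
    F = (fst A B ≫ lift (𝟙 A) 1 ≫ F) * (snd A B ≫ lift 1 (𝟙 B) ≫ F) := by
  have := hA.isProper
  have := hB.isProper
  have := hC.isProper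
  have := hA.isIntegral_tensorObj hB
  have := hC.isCommMonObj
  have h11 (T : Over (Spec (.of K))) : lift (1 : T ⟶ A) (1 : T ⟶ B) ≫ F = 1 := by
    rw [Hom.one_def, Hom.one_def, ← comp_lift, Category.assoc, hF, Hom.one_def]
  -- The quotient of the two sides is trivial on both axes, so rigidity applies to it.
  rw [← div_eq_one]
  refine (eq_const_of_const_on_axes η[A] η[B] η[C] _ ?_ ?_).trans Hom.one_def.symm
  · rw [GrpObj.comp_div, MonObj.comp_mul, ← Hom.one_def, div_eq_one]
    rw [whiskerRight_fst_assoc, whiskerRight_snd_assoc]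
    rw [comp_lift_assoc, comp_lift_assoc, comp_lift_assoc]
    simp only [MonObj.comp_one, Category.comp_id, MonObj.one_eq_one, h11, _root_.one_mul]
    congr 1
  · rw [GrpObj.comp_div, MonObj.comp_mul, ← Hom.one_def, div_eq_one]
    rw [whiskerLeft_fst_assoc, whiskerLeft_snd_assoc]
    rw [comp_lift_assoc, comp_lift_assoc, comp_lift_assoc]
    simp only [MonObj.comp_one, Category.comp_id, MonObj.one_eq_one, h11, _root_.mul_one]
    congr 1
    apply CartesianMonoidalCategory.hom_ext <;> simp

/-- A pointed morphism of abelian varieties is a homomorphism. -/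
theorem isMonHom_of_map_one {A B : Over (Spec (.of K))} [GrpObj A] [GrpObj B]
    (hA : IsAbelianVariety A) (hB : IsAbelianVariety B)
    (f : A ⟶ B) (hf : η[A] ≫ f = η[B]) : IsMonHom f where
  one_hom := hf
  mul_hom := by
    -- Both axis restrictions of `f (x + y)` are `f`.
    have h := eq_mul_of_map_one hA hA hB (μ[A] ≫ f) (by
      rw [← Category.assoc, ← Hom.mul_def, MonObj.one_eq_one, _root_.mul_one, ← MonObj.one_eq_one, hf])
    rw [h, ← Category.assoc (lift _ _), ← Category.assoc (lift _ _), ← Hom.mul_def, ← Hom.mul_def,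
      _root_.mul_one, _root_.one_mul, Category.id_comp, MonObj.mul_eq_mul, MonObj.comp_mul]
    simp

end AbelianVariety

/-! ### Retracts and splitting of idempotent endomorphisms -/

section Retract

/-- Pullback of functions along `r` is injective, since pullback along `i` undoes it. -/
lemma isReduced_of_retract {X E : Scheme.{u}} [IsReduced X] (i : E ⟶ X) (r : X ⟶ E)
    (h : i ≫ r = 𝟙 E) : IsReduced E := by
  refine ⟨fun U ↦ isReduced_of_injective (r.app U).hom ?_⟩
  intro a b hab
  have key (a : Γ(E, U)) : (i.app (r ⁻¹ᵁ U)).hom ((r.app U).hom a) =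
      ((i ≫ r).app U).hom a := by
    rw [Scheme.Hom.comp_app]; rfl
  have := congrArg (i.app (r ⁻¹ᵁ U)).hom hab
  rw [key, key] at this
  have hinj : Function.Injective ((i ≫ r).app U).hom := by
    have : IsIso (i ≫ r) := by rw [h]; infer_instance
    exact (ConcreteCategory.bijective_of_isIso ((i ≫ r).app U)).1
  exact hinj this

lemma isIntegral_of_retract {X E : Scheme.{u}} [IsIntegral X] (i : E ⟶ X) (r : X ⟶ E)
    (h : i ≫ r = 𝟙 E) : IsIntegral E := by
  have := isReduced_of_retract i r h
  have hr : Function.Surjective r := fun x ↦ ⟨i x, by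
    rw [← Scheme.Hom.comp_apply, h]; simp⟩
  have : IrreducibleSpace E := by
    have := (IrreducibleSpace.isIrreducible_univ X).image r r.continuous.continuousOn
    rw [Set.image_univ, hr.range_eq] at this
    have := (irreducibleSpace_def E).mpr this
    exact this
  exact isIntegral_of_irreducibleSpace_of_isReduced E

open Limits in
-- Base change preserves retracts, which reduces the claim to `isIntegral_of_retract` over each
-- field.
lemma geometricallyIntegral_of_retract {X E S : Scheme.{u}} (a : X ⟶ S) (b : E ⟶ S)
    [GeometricallyIntegral a] (i : E ⟶ X) (r : X ⟶ E) (hi : i ≫ a = b) (hr : r ≫ b = a)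
    (h : i ≫ r = 𝟙 E) : GeometricallyIntegral b := by
  refine ⟨fun L _ y Z p q hZ ↦ ?_⟩
  have : IsIntegral (pullback a y) :=
    GeometricallyIntegral.geometrically_isIntegral y _ _ (.of_hasPullback _ _)
  refine isIntegral_of_retract (pullback.lift (p ≫ i) q (by rw [Category.assoc, hi, hZ.w]))
    (hZ.lift (pullback.fst a y ≫ r) (pullback.snd a y)
      (by rw [Category.assoc, hr, pullback.condition])) ?_
  apply hZ.hom_ext
  · rw [Category.assoc, hZ.lift_fst, pullback.lift_fst_assoc, Category.assoc, h, Category.comp_id,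
      Category.id_comp]
  · rw [Category.assoc, hZ.lift_snd, pullback.lift_snd, Category.id_comp]

end Retract

section Splitting

variable {C : Type u} [Category.{v} C] [CartesianMonoidalCategory C]

/-- The group structure on a retract of a group object through which an idempotent endomorphism
factors. -/
abbrev grpObjOfRetract {A E : C} [GrpObj A] (i : E ⟶ A) (r : A ⟶ E) [IsMonHom (r ≫ i)]
    (h : i ≫ r = 𝟙 E) : GrpObj E :=
  -- Only `r ≫ i` is known to be a homomorphism, so each axiom is checked after composing with the
  -- monomorphism `i`, where it becomes an axiom of `A`.
  have : Mono i := mono_of_mono_fac h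
  have hone : (η[A] ≫ r) ≫ i = 1 := by rw [Category.assoc, IsMonHom.one_hom, MonObj.one_eq_one]
  have hmul : ((i ⊗ₘ i) ≫ μ[A] ≫ r) ≫ i = (fst E E ≫ i) * (snd E E ≫ i) := by
    rw [Category.assoc, Category.assoc, IsMonHom.mul_hom, tensorHom_comp_tensorHom_assoc,
      reassoc_of% h, MonObj.mul_eq_mul, MonObj.comp_mul]
    simp
  have hinv : (i ≫ ι[A] ≫ r) ≫ i = i⁻¹ := by
    rw [Category.assoc, Category.assoc, GrpObj.inv_hom (r ≫ i), Category.assoc, reassoc_of% h,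
      Hom.inv_def]
  { one := η[A] ≫ r
    mul := (i ⊗ₘ i) ≫ μ[A] ≫ r
    inv := i ≫ ι[A] ≫ r
    one_mul := by
      rw [← cancel_mono i, Category.assoc, hmul, MonObj.comp_mul, whiskerRight_fst_assoc, hone]
      simp [leftUnitor_hom]
    mul_one := by
      rw [← cancel_mono i, Category.assoc, hmul, MonObj.comp_mul, whiskerLeft_snd_assoc, hone]
      simp [rightUnitor_hom]
    mul_assoc := by
      rw [← cancel_mono i, Category.assoc, hmul, MonObj.comp_mul, whiskerRight_fst_assoc, hmul,
        Category.assoc, Category.assoc, hmul, MonObj.comp_mul, MonObj.comp_mul, MonObj.comp_mul,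
        whiskerLeft_snd_assoc, hmul, MonObj.comp_mul, MonObj.comp_mul]
      simp [_root_.mul_assoc]
    left_inv := by
      rw [← cancel_mono i, Category.assoc, hmul, MonObj.comp_mul, lift_fst_assoc, hinv,
        Category.assoc, hone]
      simp
    right_inv := by
      rw [← cancel_mono i, Category.assoc, hmul, MonObj.comp_mul, lift_snd_assoc, hinv,
        Category.assoc, hone]
      simp }

end Splitting

section AbelianVariety

variable {K : Type u} [Field K]

open Limits in
/-- Idempotent endomorphisms of abelian varieties split. -/
theorem IsAbelianVariety.exists_splitting {A : Over (Spec (.of K))} [GrpObj A]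
    (hA : IsAbelianVariety A) (p : A ⟶ A) [hp : IsMonHom p] (hpp : p ≫ p = p) :
    ∃ (E : Over (Spec (.of K))) (_ : GrpObj E) (i : E ⟶ A) (r : A ⟶ E), IsAbelianVariety E ∧
      IsMonHom i ∧ IsMonHom r ∧ i ≫ r = 𝟙 E ∧ r ≫ i = p := by
  have := hA.isProper
  have := hA.geometricallyIntegral
  -- The image of an idempotent is its fixed locus; as an equalizer it is closed in `A`, hence
  -- proper.
  let E := equalizer p (𝟙 A)
  let i : E ⟶ A := equalizer.ι p (𝟙 A)
  let r : A ⟶ E := equalizer.lift p (by simp [hpp])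
  have hri : r ≫ i = p := equalizer.lift_ι _ _
  have hip : i ≫ p = i := by
    have := equalizer.condition p (𝟙 A)
    rwa [Category.comp_id] at this
  have hir : i ≫ r = 𝟙 E := by
    rw [← cancel_mono (equalizer.ι p (𝟙 A))]
    change (i ≫ r) ≫ i = 𝟙 E ≫ i
    rw [Category.assoc, hri, hip, Category.id_comp]
  have : IsMonHom (r ≫ i) := hri ▸ hp
  have hirl : i.left ≫ r.left = 𝟙 _ := by rw [← Over.comp_left, hir]; rfl
  have : GeometricallyIntegral E.hom :=
    geometricallyIntegral_of_retract A.hom E.hom i.left r.left (Over.w i) (Over.w r) hirl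
  have : IsProper E.hom := by
    have : IsClosedImmersion i.left := isClosedImmersion_equalizer_ι_left _ _
    rw [← Over.w i]
    infer_instance
  let _ : GrpObj E := grpObjOfRetract i r hir
  have hmul : μ[E] = (i ⊗ₘ i) ≫ μ[A] ≫ r := rfl
  have hone : η[E] = η[A] ≫ r := rfl
  refine ⟨E, inferInstance, i, r, ⟨inferInstance, inferInstance⟩, ⟨?_, ?_⟩, ⟨rfl, ?_⟩, hir, hri⟩
  · rw [hone, Category.assoc, IsMonHom.one_hom]
  · rw [hmul, Category.assoc, Category.assoc, IsMonHom.mul_hom, tensorHom_comp_tensorHom_assoc,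
      reassoc_of% hir]
  · rw [hmul, tensorHom_comp_tensorHom_assoc, ← IsMonHom.mul_hom_assoc, Category.assoc, hir,
      Category.comp_id]

end AbelianVariety

/-! ### Semigroup laws of the form `φ x + ψ y` -/

section LinearLaws

variable {C : Type u} [Category.{v} C] [CartesianMonoidalCategory C] {A : C}

/-- Homomorphisms to a product of semigroups are pairs of homomorphisms. -/
lemma isSemigroupHom_prodLaw_iff {X Y : C} {m : A ⊗ A ⟶ A} {n : X ⊗ X ⟶ X} {p : Y ⊗ Y ⟶ Y}
    {f : A ⟶ X ⊗ Y} : IsSemigroupHom m (prodLaw n p) f ↔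
      IsSemigroupHom m n (f ≫ fst X Y) ∧ IsSemigroupHom m p (f ≫ snd X Y) := by
  simp only [IsSemigroupHom, prodLaw]
  constructor
  · intro h
    exact ⟨by rw [reassoc_of% h]; simp, by rw [reassoc_of% h]; simp⟩
  · rintro ⟨h₁, h₂⟩
    apply CartesianMonoidalCategory.hom_ext
    · simp [h₁]
    · simp [h₂]

variable [GrpObj A]

/-- Associativity of the law `(x, y) ↦ φ x + ψ y` means that `φ` and `ψ` are commuting
idempotents. -/
lemma IsSemigroupLaw.comp_eq_of_eq_mul {m : A ⊗ A ⟶ A} (hm : IsSemigroupLaw m) {φ ψ : A ⟶ A}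
    [IsMonHom φ] [IsMonHom ψ] (h : m = (fst A A ≫ φ) * (snd A A ≫ ψ)) :
    φ ≫ φ = φ ∧ ψ ≫ ψ = ψ ∧ φ ≫ ψ = ψ ≫ φ := by
  have key (x y z : A ⟶ A) :
      ((x ≫ φ * y ≫ ψ) ≫ φ) * z ≫ ψ = x ≫ φ * (y ≫ φ * z ≫ ψ) ≫ ψ := by
    have hl (x y : A ⟶ A) : lift x y ≫ m = x ≫ φ * y ≫ ψ := by
      rw [h, MonObj.comp_mul]; simp
    have := congr(lift (lift x y) z ≫ $hm)
    simpa [hl] using this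
  -- Setting two of the three variables to the neutral element isolates each relation.
  refine ⟨?_, ?_, ?_⟩
  · simpa using key (𝟙 A) 1 1
  · simpa using (key 1 1 (𝟙 A)).symm
  · simpa using (key 1 (𝟙 A) 1).symm

end LinearLaws

/-! ### Existence of the decomposition -/

section Existence

variable {C : Type u} [Category.{v} C] [CartesianMonoidalCategory C]

/-- A group object is the product of the images of four orthogonal idempotents with product the
identity. -/
def isoTensorOfIdempotents {A E₁ E₂ E₃ E₄ : C} [GrpObj A] [GrpObj E₁] [GrpObj E₂] [GrpObj E₃]
    [GrpObj E₄] (i₁ : E₁ ⟶ A) (i₂ : E₂ ⟶ A) (i₃ : E₃ ⟶ A) (i₄ : E₄ ⟶ A)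
    (r₁ : A ⟶ E₁) (r₂ : A ⟶ E₂) (r₃ : A ⟶ E₃) (r₄ : A ⟶ E₄)
    [IsMonHom r₁] [IsMonHom r₂] [IsMonHom r₃] [IsMonHom r₄]
    (h₁ : i₁ ≫ r₁ = 𝟙 _) (h₂ : i₂ ≫ r₂ = 𝟙 _) (h₃ : i₃ ≫ r₃ = 𝟙 _) (h₄ : i₄ ≫ r₄ = 𝟙 _)
    (h₁₂ : i₁ ≫ r₂ = 1) (h₁₃ : i₁ ≫ r₃ = 1) (h₁₄ : i₁ ≫ r₄ = 1)
    (h₂₁ : i₂ ≫ r₁ = 1) (h₂₃ : i₂ ≫ r₃ = 1) (h₂₄ : i₂ ≫ r₄ = 1)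
    (h₃₁ : i₃ ≫ r₁ = 1) (h₃₂ : i₃ ≫ r₂ = 1) (h₃₄ : i₃ ≫ r₄ = 1)
    (h₄₁ : i₄ ≫ r₁ = 1) (h₄₂ : i₄ ≫ r₂ = 1) (h₄₃ : i₄ ≫ r₃ = 1)
    (h : r₁ ≫ i₁ * (r₂ ≫ i₂ * (r₃ ≫ i₃ * r₄ ≫ i₄)) = 𝟙 A) :
    A ≅ E₁ ⊗ (E₂ ⊗ (E₃ ⊗ E₄)) where
  hom := lift r₁ (lift r₂ (lift r₃ r₄))
  inv := (fst _ _ ≫ i₁) * ((snd _ _ ≫ fst _ _ ≫ i₂) *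
    ((snd _ _ ≫ snd _ _ ≫ fst _ _ ≫ i₃) * (snd _ _ ≫ snd _ _ ≫ snd _ _ ≫ i₄)))
  hom_inv_id := by simpa [MonObj.comp_mul] using h
  inv_hom_id := by
    refine CartesianMonoidalCategory.hom_ext _ _ ?_ (CartesianMonoidalCategory.hom_ext _ _ ?_
      (CartesianMonoidalCategory.hom_ext _ _ ?_ ?_)) <;>
    simp [MonObj.mul_comp, *]

variable {K : Type u} [Field K] [IsAlgClosed K]

/-- An abelian variety with a pointed semigroup law decomposes. -/
theorem nonempty_decomposition {A : Over (Spec (.of K))} [GrpObj A] (hA : IsAbelianVariety A)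
    (m : A ⊗ A ⟶ A) (hm : IsSemigroupLaw m) (he : lift η[A] η[A] ≫ m = η[A]) :
    Nonempty (Decomposition A m) := by
  have := hA.isCommMonObj
  have h1 (T : Over (Spec (.of K))) : lift (1 : T ⟶ A) (1 : T ⟶ A) ≫ m = 1 := by
    rw [Hom.one_def, ← comp_lift, Category.assoc, he]
  have hom (f : A ⟶ A) (hf : η ≫ f = η) : IsMonHom f := isMonHom_of_map_one hA hA f hf
  obtain ⟨φ, hφ⟩ : ∃ φ : A ⟶ A, φ = lift (𝟙 A) 1 ≫ m := ⟨_, rfl⟩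
  obtain ⟨ψ, hψ⟩ : ∃ ψ : A ⟶ A, ψ = lift 1 (𝟙 A) ≫ m := ⟨_, rfl⟩
  have : IsMonHom φ := hom _ <| by
    rw [hφ, comp_lift_assoc, Category.comp_id, MonObj.comp_one, MonObj.one_eq_one, h1]
  have : IsMonHom ψ := hom _ <| by
    rw [hψ, comp_lift_assoc, Category.comp_id, MonObj.comp_one, MonObj.one_eq_one, h1]
  have hmul : m = (fst A A ≫ φ) * (snd A A ≫ ψ) := by
    rw [hφ, hψ]
    exact eq_mul_of_map_one hA hA hA m he
  obtain ⟨hφφ, hψψ, hφψ⟩ := hm.comp_eq_of_eq_mul hmul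
  have hψφψ : ψ ≫ φ ≫ ψ = ψ ≫ φ := by rw [hφψ, reassoc_of% hψψ]
  have split (p : A ⟶ A) (hp : η ≫ p = η) (hpp : p ≫ p = p) :=
    have := hom p hp
    hA.exists_splitting p hpp
  -- Additively: `φψ`, `φ(1 - ψ)`, `(1 - φ)ψ` and `(1 - φ)(1 - ψ)`.
  obtain ⟨pB, hpB⟩ : ∃ p : A ⟶ A, p = φ ≫ ψ := ⟨_, rfl⟩
  obtain ⟨pl, hpl⟩ : ∃ p : A ⟶ A, p = φ / φ ≫ ψ := ⟨_, rfl⟩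
  obtain ⟨pr, hpr⟩ : ∃ p : A ⟶ A, p = ψ / φ ≫ ψ := ⟨_, rfl⟩
  obtain ⟨p0, hp0⟩ : ∃ p : A ⟶ A, p = 𝟙 A / (φ * ψ / φ ≫ ψ) := ⟨_, rfl⟩
  have eB : η ≫ pB = η := by simp [hpB]
  have el : η ≫ pl = η := by simp [hpl, GrpObj.comp_div, MonObj.one_eq_one]
  have er : η ≫ pr = η := by simp [hpr, GrpObj.comp_div, MonObj.one_eq_one]
  have e0 : η ≫ p0 = η := by simp [hp0, GrpObj.comp_div, MonObj.comp_mul, MonObj.one_eq_one]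
  have := hom _ eB
  have := hom _ el
  have := hom _ er
  have := hom _ e0
  -- Each of `φ`, `ψ` acts as `0` or `1` on each summand. These eight relations give both the
  -- orthogonality of the idempotents and the form of the law on each factor.
  have φB : φ ≫ pB = pB := by rw [hpB, reassoc_of% hφφ]
  have ψB : ψ ≫ pB = pB := by rw [hpB, hψφψ, hφψ]
  have φl : φ ≫ pl = pl := by rw [hpl, GrpObj.comp_div, hφφ, reassoc_of% hφφ]
  have ψl : ψ ≫ pl = 1 := by rw [hpl, GrpObj.comp_div, hψφψ, div_self']
  have φr : φ ≫ pr = 1 := by rw [hpr, GrpObj.comp_div, reassoc_of% hφφ, div_self']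
  have ψr : ψ ≫ pr = pr := by rw [hpr, GrpObj.comp_div, hψψ, hψφψ, hφψ]
  have φ0 : φ ≫ p0 = 1 := by
    rw [hp0, GrpObj.comp_div, GrpObj.comp_div, MonObj.comp_mul, hφφ, reassoc_of% hφφ]
    simp
  have ψ0 : ψ ≫ p0 = 1 := by
    rw [hp0, GrpObj.comp_div, GrpObj.comp_div, MonObj.comp_mul, hψψ, hψφψ]
    simp
  have comp_B (q : A ⟶ A) : pB ≫ q = φ ≫ ψ ≫ q := by rw [hpB, Category.assoc]
  have comp_l (q : A ⟶ A) [IsMonHom q] : pl ≫ q = (φ ≫ q) / φ ≫ ψ ≫ q := by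
    rw [hpl, GrpObj.div_comp, Category.assoc]
  have comp_r (q : A ⟶ A) [IsMonHom q] : pr ≫ q = (ψ ≫ q) / φ ≫ ψ ≫ q := by
    rw [hpr, GrpObj.div_comp, Category.assoc]
  have comp_0 (q : A ⟶ A) [IsMonHom q] :
      p0 ≫ q = q / ((φ ≫ q) * (ψ ≫ q) / φ ≫ ψ ≫ q) := by
    rw [hp0, GrpObj.div_comp, GrpObj.div_comp, MonObj.mul_comp, Category.assoc, Category.id_comp]
  obtain ⟨E0, _, i0, r0, ab0, hi0, hr0, ir0, ri0⟩ := split p0 e0 (by simp [comp_0, φ0, ψ0])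
  obtain ⟨El, _, il, rl, abl, hil, hrl, irl, ril⟩ := split pl el (by simp [comp_l, φl, ψl])
  obtain ⟨Er, _, ir, rr, abr, hir, hrr, irr, rir⟩ := split pr er (by simp [comp_r, φr, ψr])
  obtain ⟨EB, _, iB, rB, abB, hiB, hrB, irB, riB⟩ := split pB eB (by simp [comp_B, φB, ψB])
  have fac {E F : Over (Spec (.of K))} {i : E ⟶ A} {r : A ⟶ E} {j : F ⟶ A} {s : A ⟶ F} {p q}
      [GrpObj E] [GrpObj F] (_ : IsMonHom i) (_ : IsMonHom s) (h₁ : i ≫ r = 𝟙 E)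
      (h₁' : r ≫ i = p) (h₂ : j ≫ s = 𝟙 F) (h₂' : s ≫ j = q) (h : p ≫ q = 1) : i ≫ s = 1 := by
    calc i ≫ s = i ≫ (r ≫ i) ≫ (s ≫ j) ≫ s := by simp [h₂, reassoc_of% h₁]
      _ = 1 := by rw [h₁', h₂', reassoc_of% h]; simp
  have res {F : Over (Spec (.of K))} {j : F ⟶ A} {s : A ⟶ F} {q f g : A ⟶ A} (h₁ : j ≫ s = 𝟙 F)
      (h₂ : s ≫ j = q) (h : f ≫ q = g) : f ≫ s = g ≫ s := by
    rw [← h, ← h₂, Category.assoc, Category.assoc, h₁, Category.comp_id]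
  have res_self {F : Over (Spec (.of K))} {j : F ⟶ A} {s : A ⟶ F} {q : A ⟶ A} (h₁ : j ≫ s = 𝟙 F)
      (h₂ : s ≫ j = q) : q ≫ s = s := by rw [← h₂, Category.assoc, h₁, Category.comp_id]
  have m0 : m ≫ r0 = 1 := by
    rw [hmul, MonObj.mul_comp, Category.assoc, Category.assoc, res ir0 ri0 φ0, res ir0 ri0 ψ0]
    simp
  have ml : m ≫ rl = fst A A ≫ rl := by
    rw [hmul, MonObj.mul_comp, Category.assoc, Category.assoc, res irl ril φl, res irl ril ψl,
      res_self irl ril]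
    simp
  have mr : m ≫ rr = snd A A ≫ rr := by
    rw [hmul, MonObj.mul_comp, Category.assoc, Category.assoc, res irr rir φr, res irr rir ψr,
      res_self irr rir]
    simp
  have mB : m ≫ rB = (fst A A ≫ rB) * (snd A A ≫ rB) := by
    rw [hmul, MonObj.mul_comp, Category.assoc, Category.assoc, res irB riB φB, res irB riB ψB,
      res_self irB riB]
  refine ⟨⟨E0, El, Er, EB, ab0, abl, abr, abB,
    isoTensorOfIdempotents i0 il ir iB r0 rl rr rB ir0 irl irr irB
      (fac hi0 hrl ir0 ri0 irl ril (by simp [comp_0, φl, ψl]))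
      (fac hi0 hrr ir0 ri0 irr rir (by simp [comp_0, φr, ψr]))
      (fac hi0 hrB ir0 ri0 irB riB (by simp [comp_0, φB, ψB]))
      (fac hil hr0 irl ril ir0 ri0 (by simp [comp_l, φ0, ψ0]))
      (fac hil hrr irl ril irr rir (by simp [comp_l, φr, ψr]))
      (fac hil hrB irl ril irB riB (by simp [comp_l, φB, ψB]))
      (fac hir hr0 irr rir ir0 ri0 (by simp [comp_r, ψ0]))
      (fac hir hrl irr rir irl ril (by simp [comp_r, ψl]))
      (fac hir hrB irr rir irB riB (by simp [comp_r, φB, ψB]))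
      (fac hiB hr0 irB riB ir0 ri0 (by simp [comp_B, ψ0]))
      (fac hiB hrl irB riB irl ril (by simp [comp_B, ψl]))
      (fac hiB hrr irB riB irr rir (by simp [comp_B, φr, ψr])) ?_, ?_, ?_⟩⟩
  · rw [ri0, ril, rir, riB, hp0, hpl, hpr, hpB]
    have (a b c x : A ⟶ A) : x / (a * b / c) * (a / c * (b / c * c)) = x := by
      rw [div_mul_cancel, div_mul_eq_mul_div a c b, div_mul_cancel]
    exact this _ _ _ _
  · rw [isSemigroupHom_prodLaw_iff, isSemigroupHom_prodLaw_iff, isSemigroupHom_prodLaw_iff]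
    simp only [isoTensorOfIdempotents, lift_fst, lift_snd]
    refine ⟨?_, ?_, ?_, ?_⟩
    · simp [IsSemigroupHom, zeroLaw, m0, Hom.one_def]
    · simp [IsSemigroupHom, leftLaw, ml]
    · simp [IsSemigroupHom, rightLaw, mr]
    · simp [IsSemigroupHom, mB, MonObj.mul_eq_mul, MonObj.comp_mul]
  · simp [isoTensorOfIdempotents]

end Existence

/-! ### Components of a decomposition, idempotents and kernel -/

namespace Decomposition

variable {K : Type u} [Field K] {A : Over (Spec (.of K))} [GrpObj A] {m : A ⊗ A ⟶ A}
  (D : Decomposition A m)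

/-- The projection `A ⟶ Al`. -/
noncomputable def projAl : A ⟶ D.Al := D.iso.hom ≫ snd _ _ ≫ fst _ _

/-- The projection `A ⟶ Ar`. -/
noncomputable def projAr : A ⟶ D.Ar := D.iso.hom ≫ snd _ _ ≫ snd _ _ ≫ fst _ _

/-- The morphism to `A` with given components. -/
noncomputable def tuple {T : Over (Spec (.of K))} (a : T ⟶ D.A0) (b : T ⟶ D.Al) (c : T ⟶ D.Ar)
    (d : T ⟶ D.B) : T ⟶ A := lift a (lift b (lift c d)) ≫ D.iso.inv

variable {T : Over (Spec (.of K))}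

section

variable (a : T ⟶ D.A0) (b : T ⟶ D.Al) (c : T ⟶ D.Ar) (d : T ⟶ D.B)

@[simp] lemma tuple_projA0 : D.tuple a b c d ≫ D.projA0 = a := by simp [tuple, projA0]
@[simp] lemma tuple_projAl : D.tuple a b c d ≫ D.projAl = b := by simp [tuple, projAl]
@[simp] lemma tuple_projAr : D.tuple a b c d ≫ D.projAr = c := by simp [tuple, projAr]
@[simp] lemma tuple_projB : D.tuple a b c d ≫ D.projB = d := by simp [tuple, projB]

end

lemma iso_hom_eq_lift :
    D.iso.hom = lift D.projA0 (lift D.projAl (lift D.projAr D.projB)) := by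
  refine CartesianMonoidalCategory.hom_ext _ _ ?_ (CartesianMonoidalCategory.hom_ext _ _ ?_
    (CartesianMonoidalCategory.hom_ext _ _ ?_ ?_)) <;>
  simp [projA0, projAl, projAr, projB]

lemma ext_proj {x y : T ⟶ A} (h0 : x ≫ D.projA0 = y ≫ D.projA0)
    (hl : x ≫ D.projAl = y ≫ D.projAl) (hr : x ≫ D.projAr = y ≫ D.projAr)
    (hB : x ≫ D.projB = y ≫ D.projB) : x = y := by
  rw [← cancel_mono D.iso.hom, iso_hom_eq_lift]
  simp only [comp_lift, h0, hl, hr, hB]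

/-- The inclusion `A0 ⟶ A`. -/
noncomputable def inclA0 : D.A0 ⟶ A := D.tuple (𝟙 _) 1 1 1

/-- The inclusion `Al ⟶ A`. -/
noncomputable def inclAl : D.Al ⟶ A := D.tuple 1 (𝟙 _) 1 1

/-- The inclusion `Ar ⟶ A`. -/
noncomputable def inclAr : D.Ar ⟶ A := D.tuple 1 1 (𝟙 _) 1

/-- The inclusion `B ⟶ A`. -/
noncomputable def inclB : D.B ⟶ A := D.tuple 1 1 1 (𝟙 _)

@[simp] lemma law_projA0 : m ≫ D.projA0 = 1 := by
  have := D.isHom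
  simp only [isSemigroupHom_prodLaw_iff, Category.assoc] at this
  simpa [IsSemigroupHom, zeroLaw, Hom.one_def, projA0] using this.1

@[simp] lemma law_projAl : m ≫ D.projAl = fst A A ≫ D.projAl := by
  have := D.isHom
  simp only [isSemigroupHom_prodLaw_iff, Category.assoc] at this
  simpa [IsSemigroupHom, leftLaw, projAl] using this.2.1

@[simp] lemma law_projAr : m ≫ D.projAr = snd A A ≫ D.projAr := by
  have := D.isHom
  simp only [isSemigroupHom_prodLaw_iff, Category.assoc] at this
  simpa [IsSemigroupHom, rightLaw, projAr] using this.2.2.1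

lemma isSemigroupHom_projB : IsSemigroupHom m μ[D.B] D.projB := by
  have := D.isHom
  simp only [isSemigroupHom_prodLaw_iff, Category.assoc] at this
  exact this.2.2.2

@[simp] lemma law_projB : m ≫ D.projB = fst A A ≫ D.projB * snd A A ≫ D.projB := by
  rw [D.isSemigroupHom_projB, MonObj.mul_eq_mul, MonObj.comp_mul]
  simp

lemma one_projs : η[A] ≫ D.projA0 = η ∧ η[A] ≫ D.projAl = η ∧ η[A] ≫ D.projAr = η ∧
    η[A] ≫ D.projB = η := by
  simp [projA0, projAl, projAr, projB, reassoc_of% D.map_one]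

lemma comp_tuple {S : Over (Spec (.of K))} (f : S ⟶ T) (a : T ⟶ D.A0) (b : T ⟶ D.Al) (c : T ⟶ D.Ar)
    (d : T ⟶ D.B) : f ≫ D.tuple a b c d = D.tuple (f ≫ a) (f ≫ b) (f ≫ c) (f ≫ d) := by
  simp only [tuple, comp_lift_assoc, comp_lift]

theorem idempotents_eq :
    idempotents m = {x | x ≫ D.projA0 = η[D.A0] ∧ x ≫ D.projB = η[D.B]} := by
  ext x
  simp only [idempotents, pointMul, Set.mem_ofPred_eq, MonObj.one_eq_one]
  constructor
  · intro h
    have h0 := congr($h ≫ D.projA0)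
    have hB := congr($h ≫ D.projB)
    simp only [Category.assoc, law_projA0, law_projB, MonObj.comp_one, MonObj.comp_mul,
      lift_fst_assoc, lift_snd_assoc] at h0 hB
    exact ⟨h0.symm, by simpa using hB⟩
  · rintro ⟨h0, hB⟩
    apply D.ext_proj <;> simp [h0, hB, MonObj.comp_mul]

theorem isKernel : IsKernel m {x | x ≫ D.projA0 = η[D.A0]} := by
  constructor
  · exact ⟨⟨D.tuple 1 1 1 1, by simp [MonObj.one_eq_one]⟩,
      fun x y _ ↦ by simp [pointMul, MonObj.one_eq_one],
      fun x y _ ↦ by simp [pointMul, MonObj.one_eq_one]⟩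
  · rintro J hJ x hx
    obtain ⟨y, hy⟩ := hJ.nonempty
    -- Any `x` with trivial `A0`-component is `(a y) b`: the left factor `a` supplies the
    -- `Al`-component and corrects the `B`-component of `y`, and `b` supplies the `Ar`-component.
    have := hJ.mul_right (D.tuple 1 1 (x ≫ D.projAr) 1) _
      (hJ.mul_left (D.tuple 1 (x ≫ D.projAl) 1 ((x ≫ D.projB) * (y ≫ D.projB)⁻¹)) y hy)
    convert this using 1
    simp only [Set.mem_ofPred_eq, MonObj.one_eq_one] at hx
    apply D.ext_proj <;> simp [pointMul, hx, MonObj.comp_mul]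

variable [IsAlgClosed K]

lemma isMonHom_projA0 (hA : IsAbelianVariety A) : IsMonHom D.projA0 :=
  isMonHom_of_map_one hA D.abelianA0 _ D.one_projs.1

lemma isMonHom_projAl (hA : IsAbelianVariety A) : IsMonHom D.projAl :=
  isMonHom_of_map_one hA D.abelianAl _ D.one_projs.2.1

lemma isMonHom_projAr (hA : IsAbelianVariety A) : IsMonHom D.projAr :=
  isMonHom_of_map_one hA D.abelianAr _ D.one_projs.2.2.1

lemma isMonHom_projB (hA : IsAbelianVariety A) : IsMonHom D.projB :=
  isMonHom_of_map_one hA D.abelianB _ D.one_projs.2.2.2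

lemma tuple_one (hA : IsAbelianVariety A) : D.tuple (1 : T ⟶ _) 1 1 1 = 1 := by
  have := D.isMonHom_projA0 hA
  have := D.isMonHom_projAl hA
  have := D.isMonHom_projAr hA
  have := D.isMonHom_projB hA
  apply D.ext_proj <;> simp

lemma isMonHom_iso_hom (hA : IsAbelianVariety A) : IsMonHom D.iso.hom := by
  have := D.isMonHom_projA0 hA
  have := D.isMonHom_projAl hA
  have := D.isMonHom_projAr hA
  have := D.isMonHom_projB hA
  rw [D.iso_hom_eq_lift]
  infer_instance

lemma isMonHom_inclA0 (hA : IsAbelianVariety A) : IsMonHom D.inclA0 :=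
  isMonHom_of_map_one D.abelianA0 hA _ <| by
    rw [inclA0, comp_tuple]; simp [MonObj.one_eq_one, D.tuple_one hA]

lemma isMonHom_inclAl (hA : IsAbelianVariety A) : IsMonHom D.inclAl :=
  isMonHom_of_map_one D.abelianAl hA _ <| by
    rw [inclAl, comp_tuple]; simp [MonObj.one_eq_one, D.tuple_one hA]

lemma isMonHom_inclAr (hA : IsAbelianVariety A) : IsMonHom D.inclAr :=
  isMonHom_of_map_one D.abelianAr hA _ <| by
    rw [inclAr, comp_tuple]; simp [MonObj.one_eq_one, D.tuple_one hA]

lemma isMonHom_inclB (hA : IsAbelianVariety A) : IsMonHom D.inclB :=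
  isMonHom_of_map_one D.abelianB hA _ <| by
    rw [inclB, comp_tuple]; simp [MonObj.one_eq_one, D.tuple_one hA]

/-- The idempotent endomorphism with image `B` is `x ↦ e (x e)`. -/
lemma projB_inclB (hA : IsAbelianVariety A) :
    D.projB ≫ D.inclB = (lift (𝟙 A) 1 ≫ m) ≫ lift 1 (𝟙 A) ≫ m := by
  have := D.isMonHom_projA0 hA
  have := D.isMonHom_projAl hA
  have := D.isMonHom_projAr hA
  have := D.isMonHom_projB hA
  apply D.ext_proj <;> simp [inclB, MonObj.comp_mul]

/-- As for `B`, the right-hand side does not involve `D`, so all decompositions induce the same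
idempotent of `A`; this drives uniqueness. -/
lemma projAl_inclAl (hA : IsAbelianVariety A) :
    D.projAl ≫ D.inclAl = (lift (𝟙 A) 1 ≫ m) / (lift (𝟙 A) 1 ≫ m) ≫ lift 1 (𝟙 A) ≫ m := by
  have := D.isMonHom_projA0 hA
  have := D.isMonHom_projAl hA
  have := D.isMonHom_projAr hA
  have := D.isMonHom_projB hA
  apply D.ext_proj <;> simp [inclAl, MonObj.comp_mul, GrpObj.div_comp]

lemma projAr_inclAr (hA : IsAbelianVariety A) :
    D.projAr ≫ D.inclAr = (lift 1 (𝟙 A) ≫ m) / (lift (𝟙 A) 1 ≫ m) ≫ lift 1 (𝟙 A) ≫ m := by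
  have := D.isMonHom_projA0 hA
  have := D.isMonHom_projAl hA
  have := D.isMonHom_projAr hA
  have := D.isMonHom_projB hA
  apply D.ext_proj <;> simp [inclAr, MonObj.comp_mul, GrpObj.div_comp]

lemma projA0_inclA0 (hA : IsAbelianVariety A) :
    D.projA0 ≫ D.inclA0 = 𝟙 A / ((lift (𝟙 A) 1 ≫ m) *
      ((lift 1 (𝟙 A) ≫ m) / (lift (𝟙 A) 1 ≫ m) ≫ lift 1 (𝟙 A) ≫ m)) := by
  have := D.isMonHom_projA0 hA
  have := D.isMonHom_projAl hA
  have := D.isMonHom_projAr hA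
  have := D.isMonHom_projB hA
  apply D.ext_proj <;> simp [inclA0, MonObj.comp_mul, GrpObj.div_comp, MonObj.mul_comp]

end Decomposition

/-! ### Uniqueness and the universal homomorphism -/

section Uniqueness

variable {C : Type u} [Category.{v} C]

/-- Two splittings of the same idempotent are isomorphic. -/
@[simps] def isoOfSplittings {A E F : C} (i : E ⟶ A) (r : A ⟶ E) (j : F ⟶ A) (s : A ⟶ F)
    (h₁ : i ≫ r = 𝟙 E) (h₂ : j ≫ s = 𝟙 F) (h : r ≫ i = s ≫ j) : E ≅ F where
  hom := i ≫ s
  inv := j ≫ r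
  hom_inv_id := by
    rw [Category.assoc, ← reassoc_of% h, reassoc_of% h₁, h₁]
  inv_hom_id := by
    rw [Category.assoc, reassoc_of% h, reassoc_of% h₂, h₂]

end Uniqueness

namespace Decomposition

variable {K : Type u} [Field K] [IsAlgClosed K] {A : Over (Spec (.of K))} [GrpObj A]
  {m : A ⊗ A ⟶ A}

/-- Corresponding factors of `D` and `D'` split the same idempotent of `A`, so inclusion followed by
projection identifies them. -/
theorem existsUnique_iso (hA : IsAbelianVariety A) (D D' : Decomposition A m) :
    ∃! f : (D.A0 ≅ D'.A0) × (D.Al ≅ D'.Al) × (D.Ar ≅ D'.Ar) × (D.B ≅ D'.B),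
      IsMonHom f.1.hom ∧ IsMonHom f.2.1.hom ∧ IsMonHom f.2.2.1.hom ∧ IsMonHom f.2.2.2.hom ∧
      D'.iso.hom = D.iso.hom ≫ (f.1.hom ⊗ₘ (f.2.1.hom ⊗ₘ (f.2.2.1.hom ⊗ₘ f.2.2.2.hom))) := by
  have h0 : D.inclA0 ≫ D.projA0 = 𝟙 _ := by simp [inclA0]
  have h0' : D'.inclA0 ≫ D'.projA0 = 𝟙 _ := by simp [inclA0]
  have hl : D.inclAl ≫ D.projAl = 𝟙 _ := by simp [inclAl]
  have hl' : D'.inclAl ≫ D'.projAl = 𝟙 _ := by simp [inclAl]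
  have hr : D.inclAr ≫ D.projAr = 𝟙 _ := by simp [inclAr]
  have hr' : D'.inclAr ≫ D'.projAr = 𝟙 _ := by simp [inclAr]
  have hB : D.inclB ≫ D.projB = 𝟙 _ := by simp [inclB]
  have hB' : D'.inclB ≫ D'.projB = 𝟙 _ := by simp [inclB]
  have e0 := (D.projA0_inclA0 hA).trans (D'.projA0_inclA0 hA).symm
  have el := (D.projAl_inclAl hA).trans (D'.projAl_inclAl hA).symm
  have er := (D.projAr_inclAr hA).trans (D'.projAr_inclAr hA).symm
  have eB := (D.projB_inclB hA).trans (D'.projB_inclB hA).symm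
  refine ⟨⟨isoOfSplittings _ _ _ _ h0 h0' e0, isoOfSplittings _ _ _ _ hl hl' el,
    isoOfSplittings _ _ _ _ hr hr' er, isoOfSplittings _ _ _ _ hB hB' eB⟩,
    ⟨?_, ?_, ?_, ?_, ?_⟩, ?_⟩
  · have := D.isMonHom_inclA0 hA
    have := D'.isMonHom_projA0 hA
    exact inferInstanceAs (IsMonHom (_ ≫ _))
  · have := D.isMonHom_inclAl hA
    have := D'.isMonHom_projAl hA
    exact inferInstanceAs (IsMonHom (_ ≫ _))
  · have := D.isMonHom_inclAr hA
    have := D'.isMonHom_projAr hA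
    exact inferInstanceAs (IsMonHom (_ ≫ _))
  · have := D.isMonHom_inclB hA
    have := D'.isMonHom_projB hA
    exact inferInstanceAs (IsMonHom (_ ≫ _))
  · rw [D.iso_hom_eq_lift, D'.iso_hom_eq_lift]
    simp only [lift_map, isoOfSplittings_hom, reassoc_of% e0, reassoc_of% el, reassoc_of% er,
      reassoc_of% eB, h0', hl', hr', hB', Category.comp_id]
  -- Only the compatibility equation enters, so uniqueness holds among all isomorphisms of
  -- varieties.
  · rintro ⟨f0, fl, fr, fB⟩ ⟨-, -, -, -, hf⟩
    rw [D.iso_hom_eq_lift, D'.iso_hom_eq_lift, lift_map, lift_map, lift_map] at hf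
    have g0 := by simpa using congr($hf ≫ fst _ _)
    have gl := by simpa using congr($hf ≫ snd _ _ ≫ fst _ _)
    have gr := by simpa using congr($hf ≫ snd _ _ ≫ snd _ _ ≫ fst _ _)
    have gB := by simpa using congr($hf ≫ snd _ _ ≫ snd _ _ ≫ snd _ _)
    refine Prod.ext ?_ (Prod.ext ?_ (Prod.ext ?_ ?_)) <;> ext1
    · simp [g0, reassoc_of% h0]
    · simp [gl, reassoc_of% hl]
    · simp [gr, reassoc_of% hr]
    · simp [gB, reassoc_of% hB]

theorem isUniversalHomToGroup_projB (hA : IsAbelianVariety A) (D : Decomposition A m) :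
    IsUniversalHomToGroup m D.projB where
  isVariety := D.abelianB.isVariety
  isHom := D.isSemigroupHom_projB
  existsUnique_fac H _ _ f hf := by
    have hB : D.inclB ≫ D.projB = 𝟙 _ := by simp [inclB]
    have := D.isMonHom_projA0 hA
    have := D.isMonHom_projAl hA
    have := D.isMonHom_projAr hA
    have := D.isMonHom_projB hA
    have := D.isMonHom_inclB hA
    have mulf {T : Over (Spec (.of K))} (x y : T ⟶ A) : lift x y ≫ m ≫ f = x ≫ f * y ≫ f := by
      rw [hf, lift_map_assoc, Hom.mul_def]
    -- The image of the idempotent `e` is an idempotent of a group, hence neutral.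
    have onef {T : Over (Spec (.of K))} : (1 : T ⟶ A) ≫ f = 1 := by
      have h : lift (1 : T ⟶ A) 1 ≫ m = 1 := by
        apply D.ext_proj <;> simp [MonObj.comp_mul]
      have := mulf (1 : T ⟶ A) 1
      rw [reassoc_of% h] at this
      simpa using this
    -- This is `f (e (x e)) = f e * (f x * f e) = f x`.
    have fac : D.projB ≫ D.inclB ≫ f = f := by
      have := D.projB_inclB hA
      rw [reassoc_of% this, mulf, onef, _root_.one_mul, Category.id_comp, mulf, onef,
        _root_.mul_one, Category.id_comp]
    refine ⟨D.inclB ≫ f, ⟨⟨?_, ?_⟩, fac⟩, ?_⟩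
    · rw [IsMonHom.one_hom_assoc, MonObj.one_eq_one, onef, MonObj.one_eq_one]
    -- The inclusion of `B` is also a semigroup homomorphism into `(A, m)`, so its composite with
    -- `f` is multiplicative.
    · have : μ[D.B] ≫ D.inclB = lift (fst _ _ ≫ D.inclB) (snd _ _ ≫ D.inclB) ≫ m := by
        apply D.ext_proj <;> simp [inclB, MonObj.mul_eq_mul, MonObj.comp_mul]
      rw [reassoc_of% this, mulf, MonObj.mul_eq_mul, MonObj.comp_mul]
      simp
    · rintro g ⟨-, hg⟩
      rw [← hg, reassoc_of% hB]

end Decomposition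

end AlgSemigroup

theorem proposition4p1 {K : Type u} [Field K] [IsAlgClosed K]
    (A : Over (Spec (.of K))) [GrpObj A] (hA : AlgSemigroup.IsAbelianVariety A)
    (m : A ⊗ A ⟶ A) (hm : AlgSemigroup.IsSemigroupLaw m)
    (e : 𝟙_ (Over (Spec (.of K))) ⟶ A) (he : e ∈ AlgSemigroup.idempotents m) (he0 : η[A] = e) :
    -- existence of the decomposition
    Nonempty (AlgSemigroup.Decomposition A m) ∧
    -- every decomposition of semigroups is also one of algebraic groups
    (∀ D : AlgSemigroup.Decomposition A m, IsMonHom D.iso.hom) ∧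
    -- uniqueness of the decomposition
    (∀ D D' : AlgSemigroup.Decomposition A m,
      ∃! f : (D.A0 ≅ D'.A0) × (D.Al ≅ D'.Al) × (D.Ar ≅ D'.Ar) × (D.B ≅ D'.B),
        IsMonHom f.1.hom ∧ IsMonHom f.2.1.hom ∧ IsMonHom f.2.2.1.hom ∧ IsMonHom f.2.2.2.hom ∧
        D'.iso.hom =
          D.iso.hom ≫ (f.1.hom ⊗ₘ (f.2.1.hom ⊗ₘ (f.2.2.1.hom ⊗ₘ f.2.2.2.hom)))) ∧
    -- universal homomorphism, idempotents and kernel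
    (∀ D : AlgSemigroup.Decomposition A m,
      AlgSemigroup.IsUniversalHomToGroup m D.projB ∧
      AlgSemigroup.idempotents m = {x | x ≫ D.projA0 = η[D.A0] ∧ x ≫ D.projB = η[D.B]} ∧
      AlgSemigroup.IsKernel m {x | x ≫ D.projA0 = η[D.A0]}) := by
  refine ⟨AlgSemigroup.nonempty_decomposition hA m hm (he0 ▸ he), fun D ↦ D.isMonHom_iso_hom hA,
    fun D D' ↦ D.existsUnique_iso hA D', fun D ↦
      ⟨D.isUniversalHomToGroup_projB hA, D.idempotents_eq, D.isKernel⟩⟩
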